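/- Let $n\ge 1$. Read $[n]=\{1,\dots,n\}$ cyclically (mod $n$), and for $t\in[n]$ let $<_t$ be the linear order $t<_t t+1<_t\cdots<_t n<_t 1<_t\cdots<_t t-1$. For $A=\{i_1<_t\cdots<_t i_k\}$ and $B=\{j_1<_t\cdots<_t j_k\}$ write $A\le_t B$ if $i_s\le_t j_s$ for all $s$; sets of different sizes are not comparable. A decorated permutation $\pi^{:}=(\pi,col)$ is a permutation $\pi\in S_n$ with a map $col:\{i:\pi(i)=i\}\to\{1,-1\}$. Its Grassmann necklace is $(I_1,\dots,I_n)$ with $$I_r=\{i\in[n] : i<_r\pi^{-1}(i)\ \text{ or }\ (\pi(i)=i\text{ and }col(i)=-1)\},$$ and its positroid is $\mathcal M_{\pi^{:}}=\{H\subseteq[n] : I_t\le_t H\text{ for all }t\in[n]\}$ (a family of bases). For $j\in[n]$ put $\mathcal M/\{j\}=\{I\setminus\{j\} : j\in I\in\mathcal M\}$, again regarded as a family of subsets of $[n]$. If this family is empty, it is by convention regarded as the positroid $\{\emptyset\}$ of rank $0$. **Theorem.** Let $\pi^{:}=(\pi,col)$ be a decorated permutation and $j\in[n]$. There is exactly one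 decorated permutation $\mu^{:}=(\mu,col')$ whose positroid is $\mathcal M_{\pi^{:}}/\{j\}$ (with the above convention; the family $\mathcal M_{\pi^{:}}/\{j\}$ is empty if and only if $\pi(j)=j$ and $col(j)=+1$), and it is given as follows. 1. If $\pi(j)\ne j$, then $(\mu,col')$ is the output of the following algorithm, which terminates: - Set $\mu\Leftarrow\pi$, $col'\Leftarrow col$, then $\mu(j)\Leftarrow j$, $col'(j)\Leftarrow 1$, $a\Leftarrow j+1$, $q\Leftarrow\pi(j)$. - While $\pi(a)\ne j$: if $q=a$ or $q<_{a+1}\pi(a)<_{a+1}j$, then set $\mu(a)\Leftarrow q$, set $q\Leftarrow\pi(a)$, and, if now $\mu(a)=a$, set $col'(a)\Leftarrow 1$; in every case then set $a\Leftarrow a+1$ (mod $n$). - Finally set $\mu(a)\Leftarrow q$ and, if now $\mu(a)=a$, set $col'(a)\Leftarrow 1$. 2. If $\pi(j)=j$ and $col(j)=-1$, then $\mu=\pi$, $col'(j)=1$, and $col'(i)=col(i)$ for every fixed point $i\ne j$ of $\pi$. 3. If $\pi(j)=j$ and $col(j)=+1$, then $\mu$ is the identity permutation and $col'(i)=1$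 for all $i\in[n]$. -/

import Mathlib

/-! The base set `[n]` is `Fin n`, read cyclically (`a + 1` is addition modulo `n`). -/

namespace Positroid

/-- The strict order `a <_t b` on `[n]`, in which `t <_t t + 1 <_t ⋯ <_t t - 1`. -/
abbrev cycLT {n : ℕ} (t a b : Fin n) : Prop := a - t < b - t

/-- The weak order `a ≤_t b` on `[n]`. -/
abbrev cycLE {n : ℕ} (t a b : Fin n) : Prop := a - t ≤ b - t

/-- The Gale order `A ≤_t B`: the sets have the same size `k`, and when
`A = {f 0 <_t ⋯ <_t f (k-1)}` and `B = {g 0 <_t ⋯ <_t g (k-1)}`, then `f i ≤_t g i` for all `i`. -/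
def GaleLE {n : ℕ} (t : Fin n) (A B : Finset (Fin n)) : Prop :=
  ∃ (k : ℕ) (f g : Fin k → Fin n),
    (∀ i i', i < i' → cycLT t (f i) (f i')) ∧
    (∀ i i', i < i' → cycLT t (g i) (g i')) ∧
    Finset.univ.image f = A ∧ Finset.univ.image g = B ∧
    ∀ i, cycLE t (f i) (g i)

/-- A decorated permutation: a permutation of `[n]` with its fixed points coloured by `{1, -1}`. -/
structure DecoratedPerm (n : ℕ) where
  perm : Equiv.Perm (Fin n)
  col : {i : Fin n // perm i = i} → ℤˣ

/-- The colouring as a partial function on `[n]`, undefined (`none`) off the fixed points. -/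
def DecoratedPerm.partialCol {n : ℕ} (p : DecoratedPerm n) (i : Fin n) : Option ℤˣ :=
  if h : p.perm i = i then some (p.col ⟨i, h⟩) else none

/-- The Grassmann necklace `(I_r)` of a decorated permutation:
`i ∈ I_r` iff `i <_r π⁻¹(i)`, or `i` is a fixed point of colour `-1`. -/
def DecoratedPerm.necklace {n : ℕ} (p : DecoratedPerm n) (r : Fin n) : Set (Fin n) :=
  {i | cycLT r i (p.perm.symm i) ∨ ∃ h : p.perm i = i, p.col ⟨i, h⟩ = -1}

/-- The positroid of a decorated permutation, as its family of bases:
the sets `H` with `I_t ≤_t H` for every `t`. -/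
noncomputable def DecoratedPerm.positroid {n : ℕ} (p : DecoratedPerm n) :
    Set (Finset (Fin n)) :=
  {H | ∀ t : Fin n, GaleLE t (p.necklace t).toFinite.toFinset H}

/-- The contraction `M / T = {I - T : T ⊆ I ∈ M}` of a family of bases. Its members are again
regarded as subsets of `[n]`. -/
def contraction {n : ℕ} (M : Set (Finset (Fin n))) (T : Finset (Fin n)) :
    Set (Finset (Fin n)) :=
  {B | ∃ I ∈ M, T ⊆ I ∧ B = I \ T}

/-- `p` is a decorated permutation of the family `F`. An empty family (which arises when a
loop is contracted) is by convention treated as the positroid `{∅}` of rank zero. -/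
def DecoratedPerm.Represents {n : ℕ} (p : DecoratedPerm n) (F : Set (Finset (Fin n))) : Prop :=
  (F.Nonempty → p.positroid = F) ∧ (F = ∅ → p.positroid = {∅})

/-- The values of the program variables of the contraction algorithm: `μ`, the partial
colouring `col'`, the current position `a` and the value `q`. -/
structure AlgState (n : ℕ) where
  μ : Fin n → Fin n
  col : Fin n → Option ℤˣ
  a : Fin n
  q : Fin n

variable {n : ℕ} [NeZero n]

/-- The initial assignments: `μ ⇐ π`, `col' ⇐ col`, `μ(j) ⇐ j`, `col'(j) ⇐ 1`, `a ⇐ j + 1`,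
`q ⇐ π(j)`. -/
def algInit (p : DecoratedPerm n) (j : Fin n) : AlgState n where
  μ := Function.update p.perm j j
  col := Function.update p.partialCol j (some 1)
  a := j + 1
  q := p.perm j

/-- The assignment `μ(a) ⇐ q`, followed by `col'(a) ⇐ 1` if now `μ(a) = a`. -/
def algAssign (s : AlgState n) : AlgState n :=
  let μ' := Function.update s.μ s.a s.q
  { s with
    μ := μ'
    col := if μ' s.a = s.a then Function.update s.col s.a (some 1) else s.col }

/-- The body of the while loop: if `q = a` or `q <_{a+1} π(a) <_{a+1} j`, then assign `μ(a) ⇐ q`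
(with the colour update) and `q ⇐ π(a)`; in any case, then `a ⇐ a + 1`. -/
def algBody (p : DecoratedPerm n) (j : Fin n) (s : AlgState n) : AlgState n :=
  let s' :=
    if s.q = s.a ∨ (cycLT (s.a + 1) s.q (p.perm s.a) ∧ cycLT (s.a + 1) (p.perm s.a) j) then
      { algAssign s with q := p.perm s.a }
    else s
  { s' with a := s.a + 1 }

theorem algBody_a (p : DecoratedPerm n) (j : Fin n) (s : AlgState n) :
    (algBody p j s).a = s.a + 1 := rfl

theorem sub_succ_lt {n : ℕ} [NeZero n] (c a : Fin n) (h : a ≠ c) :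
    (c - (a + 1)).val < (c - a).val := by
  have h0 : c - a ≠ 0 := fun e => h (sub_eq_zero.mp e).symm
  have e : c - (a + 1) = (c - a) - 1 := by abel
  rw [e]
  have hpos : 0 < (c - a).val := Nat.pos_of_ne_zero fun hv => h0 (Fin.ext hv)
  have hlt := (c - a).isLt
  have h1 : (1 : Fin n).val = 1 := by
    rw [Fin.val_one', Nat.mod_eq_of_lt (by omega)]
  have hle : (1 : Fin n) ≤ c - a := by
    rw [Fin.le_def, h1]; exact hpos
  rw [Fin.sub_val_of_le hle, h1]
  omega

/-- The while loop, with guard `π(a) ≠ j`. -/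
def algLoop (p : DecoratedPerm n) (j : Fin n) (s : AlgState n) : AlgState n :=
  if p.perm s.a = j then s else algLoop p j (algBody p j s)
termination_by (p.perm.symm j - s.a).val
decreasing_by
  rename_i h
  rw [algBody_a]
  exact sub_succ_lt _ _ fun e => h (by rw [e, Equiv.apply_symm_apply])

/-- The contraction algorithm: initialise, run the while loop, and finally assign `μ(a) ⇐ q`
(with the colour update). Its output consists of the fields `μ` and `col`. -/
def contractionAlg (p : DecoratedPerm n) (j : Fin n) : AlgState n :=
  algAssign (algLoop p j (algInit p j))

end Positroid

/-! The relation A ≤_t B says that every initial segment of <_t contains at least as many elements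
of A as of B (`galeLE_iff`). In these terms I_t is the Gale minimum of the positroid at t, so the
positroid determines its necklace. The necklace determines the decorated permutation, because a
non-fixed i lies in I_t exactly for t in the cyclic interval (π⁻¹(i), i]. Together these give
uniqueness (`positroid_injective`).

For existence, let j not be a loop. Read π from position j on and order the values j+1, …, j, with j
last. The contracted permutation fixes j and gives every later record the value of the preceding
record. Let x_t be the largest value on the positions [j, t), or on the whole circle if t = j.
Moving the value x from its record a to the next record b removes x from I_t exactly for t in (a,
b], that is, when x_t = x. Hence the new necklace is I_t \ {x_t} (`neck_contract`).

Since x_t ≤_t j, adding j to a basis for the new necklace gives a basis for the old one. Conversely,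
deleting j from a basis could only fail on segments that contain x_t but not j, and there the old
inequality is strict (`cnt_lt_of_mem`). The algorithm carries the running maximum in q and may stop
at π⁻¹(j), since no record can follow the value j. -/

namespace Positroid

/-! ### Positions, counts on initial segments, and the Gale order -/

variable {n : ℕ}

/-- The position of `i` in the order `<_t`, counted from `0`. -/
def pos (t i : Fin n) : ℕ := (i - t).val

theorem pos_lt (t i : Fin n) : pos t i < n := (i - t).isLt

theorem cycLT_iff {t a b : Fin n} : cycLT t a b ↔ pos t a < pos t b := Iff.rfl

theorem cycLE_iff {t a b : Fin n} : cycLE t a b ↔ pos t a ≤ pos t b := Iff.rfl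

/-- Change of the base point of positions. -/
theorem pos_change [NeZero n] (j t i : Fin n) :
    (pos j t ≤ pos j i ∧ pos t i + pos j t = pos j i) ∨
      (pos j i < pos j t ∧ pos t i + pos j t = pos j i + n) := by
  have e : i - t = (i - j) - (t - j) := by abel
  unfold pos
  rw [e]
  generalize i - j = x
  generalize t - j = y
  have hx := x.isLt
  have hy := y.isLt
  rcases le_or_gt y x with h | h
  · left
    rw [Fin.sub_val_of_le h]
    rw [Fin.le_def] at h
    omega
  · right
    rw [Fin.sub_def]
    rw [Fin.lt_def] at h
    simp only
    rw [Nat.mod_eq_of_lt (by omega)]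
    omega

section

variable [NeZero n]

@[simp] theorem pos_self (t : Fin n) : pos t t = 0 := by simp [pos]

theorem pos_injective (t : Fin n) : Function.Injective (pos t) := fun _ _ h =>
  sub_left_injective (Fin.ext h)

theorem pos_eq_zero {t i : Fin n} : pos t i = 0 ↔ i = t := by
  rw [← pos_self t, (pos_injective t).eq_iff]

theorem pos_add_one (s t : Fin n) :
    (pos s t + 1 = n ∧ pos s (t + 1) = 0) ∨ (pos s t + 1 < n ∧ pos s (t + 1) = pos s t + 1) := by
  have e : t + 1 - s = (t - s) + 1 := by abel
  unfold pos
  rw [e]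
  generalize t - s = x
  have hx := x.isLt
  rcases Nat.lt_or_ge (x.val + 1) n with h | h
  · right
    refine ⟨h, ?_⟩
    rw [Fin.val_add, Fin.val_one', Nat.mod_eq_of_lt (show 1 < n by omega), Nat.mod_eq_of_lt h]
  · left
    refine ⟨by omega, ?_⟩
    rw [Fin.val_add, Fin.val_one', Nat.add_mod_mod, show x.val + 1 = n by omega, Nat.mod_self]

theorem pos_succ (t i : Fin n) :
    (pos t i = 0 ∧ pos (t + 1) i + 1 = n) ∨ (0 < pos t i ∧ pos (t + 1) i + 1 = pos t i) := by
  have h1 := pos_add_one t t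
  have h2 := pos_change t (t + 1) i
  have h3 := pos_lt t i
  have h4 := pos_lt (t + 1) i
  rw [pos_self] at h1
  omega

theorem exists_pos_eq (s : Fin n) {m : ℕ} (h : m < n) : ∃ i, pos s i = m :=
  ⟨⟨m, h⟩ + s, by simp [pos]⟩

theorem card_filter_pos_lt (s : Fin n) {m : ℕ} (h : m ≤ n) :
    (Finset.univ.filter fun i => pos s i < m).card = m := by
  rw [← Finset.card_range m]
  refine Finset.card_bij (fun i _ => pos s i) ?_ (fun a _ b _ e => pos_injective s e) ?_
  · intro i hi
    simpa using hi
  · intro b hb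
    rw [Finset.mem_range] at hb
    obtain ⟨i, hi⟩ := exists_pos_eq s (show b < n by omega)
    exact ⟨i, by simp [hi, hb], hi⟩

end

/-- The number of elements of `A` among the first `m` elements of `[n]` in the order `<_t`. -/
def cnt (A : Finset (Fin n)) (t : Fin n) (m : ℕ) : ℕ := (A.filter fun i => pos t i < m).card

theorem cnt_eq_sum (A : Finset (Fin n)) (t : Fin n) (m : ℕ) :
    cnt A t m = ∑ i ∈ A, if pos t i < m then 1 else 0 := Finset.card_filter _ _

theorem cnt_of_le (A : Finset (Fin n)) (t : Fin n) {m : ℕ} (h : n ≤ m) : cnt A t m = A.card := by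
  unfold cnt
  rw [Finset.filter_true_of_mem]
  exact fun i _ => (pos_lt t i).trans_le h

theorem cnt_erase {A : Finset (Fin n)} {x : Fin n} (hx : x ∈ A) (t : Fin n) (m : ℕ) :
    cnt (A.erase x) t m + (if pos t x < m then 1 else 0) = cnt A t m := by
  rw [cnt_eq_sum, cnt_eq_sum, Finset.sum_erase_add _ _ hx]

theorem cnt_insert {A : Finset (Fin n)} {x : Fin n} (hx : x ∉ A) (t : Fin n) (m : ℕ) :
    cnt (insert x A) t m = cnt A t m + (if pos t x < m then 1 else 0) := by
  rw [cnt_eq_sum, cnt_eq_sum, Finset.sum_insert hx, add_comm]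

theorem cnt_le_of_subset {A B : Finset (Fin n)} {t : Fin n} {m : ℕ}
    (h : ∀ i ∈ A, pos t i < m → i ∈ B) : cnt A t m ≤ cnt B t m := by
  refine Finset.card_le_card fun i hi => ?_
  rw [Finset.mem_filter] at hi ⊢
  exact ⟨h i hi.1 hi.2, hi.2⟩

theorem cnt_image {k : ℕ} {f : Fin k → Fin n} (hf : Function.Injective f) (t : Fin n) (m : ℕ) :
    cnt (Finset.univ.image f) t m = (Finset.univ.filter fun i => pos t (f i) < m).card := by
  unfold cnt
  rw [Finset.filter_image, Finset.card_image_of_injective _ hf]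

section

variable [NeZero n]

/-- A set is determined by its counts on the initial segments of the order `<_t`. -/
theorem eq_of_cnt_eq {A B : Finset (Fin n)} {t : Fin n} (h : ∀ m, cnt A t m = cnt B t m) :
    A = B := by
  have key : ∀ (C : Finset (Fin n)) (i : Fin n),
      cnt C t (pos t i + 1) = cnt C t (pos t i) + if i ∈ C then 1 else 0 := by
    intro C i
    rw [cnt_eq_sum, cnt_eq_sum, ← Finset.sum_ite_eq' C i (fun _ => 1), ← Finset.sum_add_distrib]
    refine Finset.sum_congr rfl fun x _ => ?_
    have hx := (pos_injective t).eq_iff (a := x) (b := i)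
    split_ifs <;> omega
  ext i
  have h1 := key A i
  have h2 := key B i
  rw [h, h] at h1
  by_cases hA : i ∈ A <;> by_cases hB : i ∈ B <;> simp_all

theorem exists_enumeration (t : Fin n) {A : Finset (Fin n)} {k : ℕ} (hk : A.card = k) :
    ∃ f : Fin k → Fin n, (∀ i i', i < i' → pos t (f i) < pos t (f i')) ∧
      Finset.univ.image f = A := by
  have hc : (A.image (· - t)).card = k := by
    rw [Finset.card_image_of_injective _ sub_left_injective, hk]
  refine ⟨fun i => (A.image (· - t)).orderEmbOfFin hc i + t, ?_, ?_⟩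
  · intro i i' h
    have := ((A.image (· - t)).orderEmbOfFin hc).strictMono h
    simpa [pos] using this
  · ext x
    have hr : x - t ∈ Set.range ((A.image (· - t)).orderEmbOfFin hc) ↔ x ∈ A := by
      rw [Finset.range_orderEmbOfFin]
      simp
    rw [← hr]
    simp only [Finset.mem_image, Finset.mem_univ, true_and, Set.mem_range, eq_sub_iff_add_eq]

theorem galeLE_iff {t : Fin n} {A B : Finset (Fin n)} :
    GaleLE t A B ↔ A.card = B.card ∧ ∀ m, cnt B t m ≤ cnt A t m := by
  have inj : ∀ {k : ℕ} {f : Fin k → Fin n}, (∀ i i', i < i' → pos t (f i) < pos t (f i')) →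
      Function.Injective f := by
    intro k f hf a b e
    rcases lt_trichotomy a b with h | h | h
    · have := hf _ _ h
      rw [e] at this
      omega
    · exact h
    · have := hf _ _ h
      rw [e] at this
      omega
  constructor
  · rintro ⟨k, f, g, hf, hg, rfl, rfl, hfg⟩
    have hf' := inj hf
    have hg' := inj hg
    refine ⟨by rw [Finset.card_image_of_injective _ hf', Finset.card_image_of_injective _ hg'],
      fun m => ?_⟩
    rw [cnt_image hf', cnt_image hg']
    refine Finset.card_le_card fun i hi => ?_
    rw [Finset.mem_filter] at hi ⊢
    exact ⟨hi.1, (cycLE_iff.1 (hfg i)).trans_lt hi.2⟩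
  · rintro ⟨hc, h⟩
    obtain ⟨k, hk⟩ : ∃ k, B.card = k := ⟨_, rfl⟩
    obtain ⟨f, hf, hfA⟩ := exists_enumeration t (hc.trans hk)
    obtain ⟨g, hg, hgB⟩ := exists_enumeration t hk
    refine ⟨_, f, g, hf, hg, hfA, hgB, fun i => ?_⟩
    rw [cycLE_iff]
    by_contra hlt
    rw [not_le] at hlt
    -- The segment ending at g i contains at least i + 1 elements of B, but at most i of A if f i
    -- comes after g i.
    have h1 := h (pos t (g i) + 1)
    rw [← hfA, ← hgB, cnt_image (inj hf), cnt_image (inj hg)] at h1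
    have h2 : (Finset.Iic i).card ≤ (Finset.univ.filter fun i' =>
        pos t (g i') < pos t (g i) + 1).card := by
      refine Finset.card_le_card fun x hx => ?_
      rw [Finset.mem_Iic] at hx
      rw [Finset.mem_filter]
      refine ⟨Finset.mem_univ _, ?_⟩
      rcases hx.lt_or_eq with hx | rfl
      · have := hg _ _ hx
        omega
      · omega
    have h3 : (Finset.univ.filter fun i' =>
        pos t (f i') < pos t (g i) + 1).card ≤ (Finset.Iio i).card := by
      refine Finset.card_le_card fun x hx => ?_
      rw [Finset.mem_filter] at hx
      rw [Finset.mem_Iio]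
      by_contra hxi
      rcases (not_lt.1 hxi).lt_or_eq with hxi | rfl
      · have := hf _ _ hxi
        omega
      · omega
    rw [Fin.card_Iic] at h2
    rw [Fin.card_Iio] at h3
    omega

end

/-! ### Necklaces, and recovering a decorated permutation from its positroid -/

namespace DecoratedPerm

/-- A fixed point of colour `-1`; it lies in every basis. -/
def IsColoop (p : DecoratedPerm n) (i : Fin n) : Prop := ∃ h : p.perm i = i, p.col ⟨i, h⟩ = -1

/-- A fixed point of colour `1`; it lies in no basis. -/
def IsLoop (p : DecoratedPerm n) (i : Fin n) : Prop := ∃ h : p.perm i = i, p.col ⟨i, h⟩ = 1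

/-- The Grassmann necklace as a family of finite sets. -/
noncomputable def neck (p : DecoratedPerm n) (t : Fin n) : Finset (Fin n) :=
  (p.necklace t).toFinite.toFinset

theorem mem_neck {p : DecoratedPerm n} {t i : Fin n} :
    i ∈ p.neck t ↔ pos t i < pos t (p.perm.symm i) ∨ p.IsColoop i := by
  rw [neck, Set.Finite.mem_toFinset]
  rfl

theorem IsColoop.not_isLoop {p : DecoratedPerm n} {i : Fin n} (h : p.IsColoop i) :
    ¬ p.IsLoop i := by
  rintro ⟨h1, h2⟩
  obtain ⟨h3, h4⟩ := h
  rw [h2] at h4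
  exact absurd h4 (by decide)

theorem isLoop_or_isColoop {p : DecoratedPerm n} {i : Fin n} (h : p.perm i = i) :
    p.IsLoop i ∨ p.IsColoop i :=
  (Int.units_eq_one_or (p.col ⟨i, h⟩)).imp (fun e => ⟨h, e⟩) fun e => ⟨h, e⟩

theorem eq_of_perm_eq {p q : DecoratedPerm n} (h1 : p.perm = q.perm)
    (h2 : ∀ i, p.IsColoop i ↔ q.IsColoop i) : p = q := by
  obtain ⟨σ, c⟩ := p
  obtain ⟨τ, d⟩ := q
  obtain rfl : σ = τ := h1
  congr 1
  funext ⟨i, hi⟩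
  have h3 : c ⟨i, hi⟩ = -1 ↔ d ⟨i, hi⟩ = -1 :=
    ⟨fun e => ((h2 i).1 ⟨hi, e⟩).2, fun e => ((h2 i).2 ⟨hi, e⟩).2⟩
  rcases Int.units_eq_one_or (c ⟨i, hi⟩) with e1 | e1 <;>
    rcases Int.units_eq_one_or (d ⟨i, hi⟩) with e2 | e2 <;> rw [e1, e2] at h3 ⊢
  · exact absurd (h3.2 rfl) (by decide)
  · exact absurd (h3.1 rfl) (by decide)

theorem IsLoop.partialCol_eq {p : DecoratedPerm n} {i : Fin n} (h : p.IsLoop i) :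
    p.partialCol i = some 1 := by
  rw [partialCol, dif_pos h.1, h.2]

theorem partialCol_eq_none {p : DecoratedPerm n} {i : Fin n} (h : p.perm i ≠ i) :
    p.partialCol i = none := dif_neg h

variable [NeZero n]

theorem mem_positroid {p : DecoratedPerm n} {H : Finset (Fin n)} :
    H ∈ p.positroid ↔
      ∀ t, (p.neck t).card = H.card ∧ ∀ m, cnt H t m ≤ cnt (p.neck t) t m :=
  forall_congr' fun _ => galeLE_iff

theorem mem_neck_self {p : DecoratedPerm n} {i : Fin n} : i ∈ p.neck i ↔ ¬ p.IsLoop i := by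
  rw [mem_neck, pos_self, Nat.pos_iff_ne_zero, Ne, pos_eq_zero, Equiv.symm_apply_eq]
  constructor
  · rintro (h | h)
    · exact fun hl => h hl.1.symm
    · exact h.not_isLoop
  · intro h
    by_cases hi : p.perm i = i
    · exact Or.inr ((isLoop_or_isColoop hi).resolve_left h)
    · exact Or.inl fun e => hi e.symm

theorem neck_add_one_of_fixed {p : DecoratedPerm n} {t : Fin n} (h : p.perm t = t) :
    p.neck (t + 1) = p.neck t := by
  ext i
  rw [mem_neck, mem_neck]
  refine or_congr_left ?_
  have h1 := pos_succ t i
  have h2 := pos_succ t (p.perm.symm i)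
  have h3 := pos_eq_zero (t := t) (i := i)
  have h4 := pos_eq_zero (t := t) (i := p.perm.symm i)
  rw [Equiv.symm_apply_eq, h] at h4
  have h5 := pos_lt t i
  have h6 := pos_lt t (p.perm.symm i)
  omega

theorem perm_apply_notMem_neck {p : DecoratedPerm n} {t : Fin n} (h : p.perm t ≠ t) :
    p.perm t ∉ p.neck t := by
  rw [mem_neck, Equiv.symm_apply_apply, pos_self]
  rintro (h1 | h1)
  · omega
  · exact h (p.perm.injective h1.1)

theorem neck_add_one {p : DecoratedPerm n} {t : Fin n} (h : p.perm t ≠ t) :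
    p.neck (t + 1) = insert (p.perm t) ((p.neck t).erase t) := by
  ext i
  rw [Finset.mem_insert, Finset.mem_erase, mem_neck, mem_neck]
  have h1 := pos_succ t i
  have h2 := pos_succ t (p.perm.symm i)
  have h3 := pos_eq_zero (t := t) (i := i)
  have h4 := pos_eq_zero (t := t) (i := p.perm.symm i)
  rw [Equiv.symm_apply_eq] at h4
  have h5 := pos_lt t i
  have h6 := pos_lt t (p.perm.symm i)
  have h7 : i = p.perm t → i ≠ t := by
    rintro rfl
    exact h
  have h8 : p.IsColoop i → i ≠ t := by
    rintro hc rfl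
    exact h hc.1
  by_cases hi : p.IsColoop i
  · simp [hi, h8 hi]
  · simp only [hi, or_false]
    omega

/-- The necklace set at `t` compared with the one at `s`, on an initial segment of `<_s`
that contains everything before `t`. -/
theorem cnt_neck_add (p : DecoratedPerm n) (s : Fin n) {u : ℕ} :
    ∀ (m : ℕ), m < u → ∀ t, pos s t = m → cnt (p.neck t) s u +
      (Finset.univ.filter fun i => pos s i < m ∧ u ≤ pos s (p.perm i)).card =
        cnt (p.neck s) s u := by
  intro m
  induction m with
  | zero =>
    intro _ t ht
    rw [pos_eq_zero] at ht
    subst ht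
    simp
  | succ m ih =>
    intro hm t ht
    obtain ⟨t, rfl⟩ : ∃ t', t = t' + 1 := ⟨t - 1, by simp⟩
    have hst : pos s t = m := by
      have := pos_add_one s t
      omega
    have IH := ih (by omega) t hst
    rw [← IH]
    -- Passing from t to t + 1 exchanges t, which lies in the segment, for π(t). The count drops
    -- exactly when π(t) lies outside.
    have hsum : (Finset.univ.filter fun i => pos s i < m + 1 ∧ u ≤ pos s (p.perm i)).card =
        (Finset.univ.filter fun i => pos s i < m ∧ u ≤ pos s (p.perm i)).card +
          if u ≤ pos s (p.perm t) then 1 else 0 := by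
      have e : (if u ≤ pos s (p.perm t) then 1 else 0) =
          ∑ i, if i = t then (if u ≤ pos s (p.perm i) then 1 else 0) else 0 := by
        rw [Finset.sum_ite_eq']
        simp
      rw [e, Finset.card_filter, Finset.card_filter, ← Finset.sum_add_distrib]
      refine Finset.sum_congr rfl fun x _ => ?_
      have hx := (pos_injective s).eq_iff (a := x) (b := t)
      split_ifs <;> omega
    rw [hsum]
    by_cases h : p.perm t = t
    · rw [neck_add_one_of_fixed h, h, hst, if_neg (by omega)]
      omega
    · have h1 : t ∈ p.neck t := mem_neck_self.2 fun hl => h hl.1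
      have h2 : p.perm t ∉ (p.neck t).erase t := fun hm =>
        perm_apply_notMem_neck h (Finset.mem_of_mem_erase hm)
      have h3 := cnt_erase h1 s u
      rw [if_pos (show pos s t < u by omega)] at h3
      rw [neck_add_one h, cnt_insert h2]
      split_ifs <;> omega

/-- This is the Gale minimality of I_s. If the segment stops before t, then i <_t π⁻¹(i) forces
π⁻¹(i) to lie before t as well, so i <_s π⁻¹(i). -/
theorem cnt_neck_le (p : DecoratedPerm n) (s t : Fin n) (u : ℕ) :
    cnt (p.neck t) s u ≤ cnt (p.neck s) s u := by
  rcases Nat.lt_or_ge (pos s t) u with h | h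
  · rw [← cnt_neck_add p s _ h t rfl]
    exact Nat.le_add_right _ _
  · refine cnt_le_of_subset fun i hi hiu => ?_
    rw [mem_neck] at hi ⊢
    refine hi.imp_left fun hi => ?_
    have h1 := pos_change s t i
    have h2 := pos_change s t (p.perm.symm i)
    have h3 := pos_lt s t
    omega

theorem card_neck (p : DecoratedPerm n) (s t : Fin n) : (p.neck t).card = (p.neck s).card := by
  have h1 := p.cnt_neck_le s t n
  have h2 := p.cnt_neck_le t s n
  rw [cnt_of_le _ _ le_rfl, cnt_of_le _ _ le_rfl] at h1 h2
  exact le_antisymm h1 h2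

theorem neck_mem_positroid (p : DecoratedPerm n) (t : Fin n) : p.neck t ∈ p.positroid :=
  mem_positroid.2 fun s => ⟨p.card_neck t s, p.cnt_neck_le s t⟩

theorem isLoop_iff_neck {p : DecoratedPerm n} {i : Fin n} : p.IsLoop i ↔ i ∉ p.neck i := by
  rw [mem_neck_self, not_not]

theorem isColoop_iff_neck {p : DecoratedPerm n} {i : Fin n} :
    p.IsColoop i ↔ ∀ t, i ∈ p.neck t := by
  refine ⟨fun h t => mem_neck.2 (Or.inr h), fun h => ?_⟩
  have := mem_neck.1 (h (p.perm.symm i))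
  rw [pos_self] at this
  exact this.resolve_left (by omega)

/-- The Grassmann necklace determines the decorated permutation. -/
theorem eq_of_neck_eq {p q : DecoratedPerm n} (h : ∀ t, p.neck t = q.neck t) : p = q := by
  have hc : ∀ i, p.IsColoop i ↔ q.IsColoop i := fun i => by
    rw [isColoop_iff_neck, isColoop_iff_neck]
    simp only [h]
  have hl : ∀ i, p.IsLoop i ↔ q.IsLoop i := fun i => by
    rw [isLoop_iff_neck, isLoop_iff_neck, h]
  refine eq_of_perm_eq ?_ hc
  have hs : ∀ i, p.perm.symm i = q.perm.symm i := by
    intro i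
    by_cases hi : p.IsLoop i ∨ p.IsColoop i
    · have hq : q.IsLoop i ∨ q.IsColoop i := by rwa [← hc, ← hl]
      have e1 : p.perm i = i := hi.elim (fun e => e.1) fun e => e.1
      have e2 : q.perm i = i := hq.elim (fun e => e.1) fun e => e.1
      rw [(Equiv.symm_apply_eq _).2 e1.symm, (Equiv.symm_apply_eq _).2 e2.symm]
    · have hq : ¬ (q.IsLoop i ∨ q.IsColoop i) := by rwa [← hc, ← hl]
      have e1 : p.perm.symm i ≠ i := fun e =>
        hi (isLoop_or_isColoop ((Equiv.symm_apply_eq _).1 e).symm)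
      have e2 : q.perm.symm i ≠ i := fun e =>
        hq (isLoop_or_isColoop ((Equiv.symm_apply_eq _).1 e).symm)
      have key : ∀ t, pos t i < pos t (p.perm.symm i) ↔ pos t i < pos t (q.perm.symm i) := by
        intro t
        have := Finset.ext_iff.1 (h t) i
        rw [mem_neck, mem_neck] at this
        rwa [or_iff_left fun hh => hi (Or.inr hh), or_iff_left fun hh => hq (Or.inr hh)] at this
      -- Non-membership of i at each of the two preimages places either preimage in the cyclic
      -- interval from the other one to i, so they coincide.
      have k1 := key (p.perm.symm i)
      have k2 := key (q.perm.symm i)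
      rw [pos_self] at k1 k2
      apply pos_injective i
      have c1 := pos_change i (p.perm.symm i) i
      have c2 := pos_change i (q.perm.symm i) i
      have c3 := pos_change i (p.perm.symm i) (q.perm.symm i)
      have c4 := pos_change i (q.perm.symm i) (p.perm.symm i)
      rw [pos_self] at c1 c2
      rw [Ne, ← pos_eq_zero] at e1 e2
      have l1 := pos_lt i (p.perm.symm i)
      have l2 := pos_lt i (q.perm.symm i)
      omega
  have : p.perm.symm = q.perm.symm := Equiv.ext hs
  rw [← p.perm.symm_symm, this, Equiv.symm_symm]

theorem cnt_neck_le_of_positroid_subset {p q : DecoratedPerm n}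
    (h : p.positroid ⊆ q.positroid) (t : Fin n) (m : ℕ) :
    cnt (p.neck t) t m ≤ cnt (q.neck t) t m :=
  (mem_positroid.1 (h (p.neck_mem_positroid t)) t).2 m

theorem positroid_injective :
    Function.Injective (positroid : DecoratedPerm n → Set (Finset (Fin n))) := fun _ _ h =>
  eq_of_neck_eq fun t => eq_of_cnt_eq fun m =>
    le_antisymm (cnt_neck_le_of_positroid_subset h.subset t m)
      (cnt_neck_le_of_positroid_subset h.symm.subset t m)

end DecoratedPerm

end Positroid

/-! ### Running maxima of a permutation read from j -/

namespace Positroid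

variable {n : ℕ}

/-- The position of `i` in the order `<_{j+1}`, counted from `1`: this is `pos j i`, except that
`j` itself comes last. -/
def wt (j i : Fin n) : ℕ := if i = j then n else pos j i

@[simp] theorem wt_self (j : Fin n) : wt j j = n := if_pos rfl

variable [NeZero n]

theorem wt_cases (j i : Fin n) :
    (i = j ∧ pos j i = 0 ∧ wt j i = n) ∨ (i ≠ j ∧ 0 < pos j i ∧ wt j i = pos j i) := by
  unfold wt
  by_cases h : i = j
  · simp [h]
  · have := pos_eq_zero (t := j) (i := i)
    rw [if_neg h]
    right
    refine ⟨h, ?_, rfl⟩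
    omega

theorem wt_le (j i : Fin n) : wt j i ≤ n := by
  have := wt_cases j i
  have := pos_lt j i
  omega

theorem wt_pos (j i : Fin n) : 0 < wt j i := by
  have := wt_cases j i
  have := pos_lt j i
  omega

theorem wt_injective (j : Fin n) : Function.Injective (wt j) := by
  intro a b h
  have h1 := wt_cases j a
  have h2 := wt_cases j b
  have h3 := pos_lt j a
  have h4 := pos_lt j b
  apply pos_injective j
  omega

section RunMax

variable (σ : Equiv.Perm (Fin n)) (j : Fin n)

theorem exists_runMax {m : ℕ} (hm : 0 < m) :
    ∃ a, pos j a < m ∧ ∀ b, pos j b < m → wt j (σ b) ≤ wt j (σ a) := by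
  obtain ⟨a, ha, h⟩ := (Finset.univ.filter fun i => pos j i < m).exists_max_image
    (fun i => wt j (σ i)) ⟨j, by simpa using hm⟩
  exact ⟨a, by simpa using ha, fun b hb => h b (by simpa using hb)⟩

open Classical in
/-- The last value, in the order `<_{j+1}`, that `σ` takes at the first `m` positions
`j, j + 1, …`. -/
noncomputable def runMax (m : ℕ) : Fin n :=
  if h : 0 < m then σ (exists_runMax σ j h).choose else j

variable {j} {m m' : ℕ}

theorem exists_eq_runMax (hm : 0 < m) : ∃ a, pos j a < m ∧ σ a = runMax σ j m :=
  ⟨_, (exists_runMax σ j hm).choose_spec.1, by rw [runMax, dif_pos hm]⟩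

theorem wt_le_runMax {a : Fin n} (ha : pos j a < m) : wt j (σ a) ≤ wt j (runMax σ j m) := by
  have hm : 0 < m := by omega
  rw [runMax, dif_pos hm]
  exact (exists_runMax σ j hm).choose_spec.2 a ha

theorem wt_runMax_mono (hm : 0 < m) (h : m ≤ m') :
    wt j (runMax σ j m) ≤ wt j (runMax σ j m') := by
  obtain ⟨a, ha, e⟩ := exists_eq_runMax σ (j := j) hm
  rw [← e]
  exact wt_le_runMax σ (ha.trans_le h)

theorem runMax_eq {a : Fin n} (ha : pos j a < m)
    (h : ∀ b, pos j b < m → wt j (σ b) ≤ wt j (σ a)) : runMax σ j m = σ a := by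
  obtain ⟨b, hb, e⟩ := exists_eq_runMax σ (j := j) (show 0 < m by omega)
  apply wt_injective j
  refine le_antisymm ?_ (wt_le_runMax σ ha)
  rw [← e]
  exact h b hb

theorem runMax_eq_self {c : Fin n} (hc : σ c = j) (h : pos j c < m) : runMax σ j m = j := by
  rw [runMax_eq σ h fun b _ => ?_, hc]
  rw [hc, wt_self]
  exact wt_le _ _

/-- Pigeonhole: m distinct values have distinct positive weights, all bounded by the largest. -/
theorem le_wt_runMax (hn : m ≤ n) : m ≤ wt j (runMax σ j m) := by
  have hcard : (Finset.univ.filter fun i => pos j i < m).card ≤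
      (Finset.Icc 1 (wt j (runMax σ j m))).card := by
    refine Finset.card_le_card_of_injOn (fun i => wt j (σ i)) (fun i hi => ?_)
      ((wt_injective j).comp σ.injective).injOn
    simp only [Finset.coe_filter, Finset.mem_univ, true_and, Set.mem_ofPred_eq] at hi
    simp only [Finset.coe_Icc, Set.mem_Icc]
    exact ⟨wt_pos _ _, wt_le_runMax σ hi⟩
  rw [card_filter_pos_lt j hn, Nat.card_Icc] at hcard
  omega

theorem runMax_succ {a : Fin n} (ha : 0 < pos j a) :
    runMax σ j (pos j a + 1) =
      if wt j (runMax σ j (pos j a)) < wt j (σ a) then σ a else runMax σ j (pos j a) := by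
  have key : ∀ b, pos j b < pos j a + 1 → b = a ∨ pos j b < pos j a := fun b hb => by
    rcases Nat.lt_succ_iff_lt_or_eq.1 hb with h | h
    · exact Or.inr h
    · exact Or.inl (pos_injective j h)
  split_ifs with h
  · refine runMax_eq σ (Nat.lt_succ_self _) fun b hb => ?_
    rcases key b hb with rfl | hb
    · exact le_rfl
    · exact (wt_le_runMax σ hb).trans h.le
  · obtain ⟨c, hc, e⟩ := exists_eq_runMax σ ha
    rw [← e] at h ⊢
    refine runMax_eq σ (hc.trans (Nat.lt_succ_self _)) fun b hb => ?_
    rcases key b hb with rfl | hb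
    · exact not_lt.1 h
    · rw [e]
      exact wt_le_runMax σ hb

end RunMax

/-! ### The shift of record values -/

section ContractPerm

variable (σ : Equiv.Perm (Fin n)) (j : Fin n)

/-- The underlying map of the contraction of a permutation: at every record of `σ`
(read from `j + 1` on), the previous record is taken instead. -/
noncomputable def contractFun (i : Fin n) : Fin n :=
  if i = j then j
  else if wt j (runMax σ j (pos j i)) < wt j (σ i) then runMax σ j (pos j i) else σ i

@[simp] theorem contractFun_self : contractFun σ j j = j := if_pos rfl

variable {j} in
theorem contractFun_cases {i : Fin n} (hi : i ≠ j) :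
    (wt j (runMax σ j (pos j i)) < wt j (σ i) ∧ contractFun σ j i = runMax σ j (pos j i)) ∨
      (wt j (σ i) < wt j (runMax σ j (pos j i)) ∧ contractFun σ j i = σ i) := by
  unfold contractFun
  rw [if_neg hi]
  split_ifs with h
  · exact Or.inl ⟨h, rfl⟩
  · refine Or.inr ⟨lt_of_le_of_ne (not_lt.1 h) fun e => ?_, rfl⟩
    have h0 := wt_cases j i
    obtain ⟨a, ha, ea⟩ := exists_eq_runMax σ (j := j) (m := pos j i) (by tauto)
    have := σ.injective (ea.trans (wt_injective j e).symm)
    subst this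
    omega

variable {j} in
theorem contractFun_ne_self {i : Fin n} (hi : i ≠ j) : contractFun σ j i ≠ j := by
  intro h
  rcases contractFun_cases σ hi with ⟨h1, h2⟩ | ⟨h1, h2⟩
  · rw [← h2, h, wt_self] at h1
    exact absurd h1 (wt_le _ _).not_gt
  · rw [← h2, h, wt_self] at h1
    exact absurd h1 (wt_le _ _).not_gt

/-- Later records receive strictly larger previous records, and non-records keep their own values. A
non-record value is already exceeded when it is read, so it is never a running maximum and cannot be
received by a record. -/
theorem contractFun_injective : Function.Injective (contractFun σ j) := by
  have main : ∀ a b, a ≠ j → b ≠ j → pos j a < pos j b → contractFun σ j a ≠ contractFun σ j b := by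
    intro a b ha hb hab e
    have h0 := wt_cases j a
    have hm := wt_runMax_mono σ (j := j) (m := pos j a) (m' := pos j b) (by omega) hab.le
    have hle := wt_le_runMax σ hab
    obtain ⟨c, hc, ec⟩ := exists_eq_runMax σ (j := j) (m := pos j a) (by omega)
    obtain ⟨d, hd, ed⟩ := exists_eq_runMax σ (j := j) (m := pos j b) (by omega)
    rcases contractFun_cases σ ha with ⟨h1, h2⟩ | ⟨h1, h2⟩ <;>
      rcases contractFun_cases σ hb with ⟨h3, h4⟩ | ⟨h3, h4⟩
    · have h5 : runMax σ j (pos j a) = runMax σ j (pos j b) := by rw [← h2, e, h4]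
      rw [h5] at h1
      omega
    · rw [e, h4, ← ec] at h2
      have := σ.injective h2
      subst this
      omega
    · rw [e, h4] at h2
      rw [h2] at hm
      omega
    · rw [e, h4] at h2
      have := σ.injective h2
      subst this
      omega
  intro a b e
  by_cases ha : a = j
  · by_contra hb
    subst ha
    rw [contractFun_self] at e
    exact contractFun_ne_self σ (Ne.symm hb) e.symm
  · by_cases hb : b = j
    · subst hb
      rw [contractFun_self] at e
      exact absurd e (contractFun_ne_self σ ha)
    · rcases lt_trichotomy (pos j a) (pos j b) with h | h | h
      · exact absurd e (main a b ha hb h)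
      · exact pos_injective j h
      · exact absurd e.symm (main b a hb ha h)

/-- The underlying permutation of the contraction by `{j}`. -/
noncomputable def contractPerm : Equiv.Perm (Fin n) :=
  Equiv.ofBijective (contractFun σ j) (Finite.injective_iff_bijective.1 (contractFun_injective σ j))

end ContractPerm

/-! ### Necklace and positroid of the contraction -/

namespace DecoratedPerm

variable (p : DecoratedPerm n) (j : Fin n)

/-- The decorated permutation of the contraction by a single element `j` that is not a loop. -/
noncomputable def contract : DecoratedPerm n where
  perm := contractPerm p.perm j
  -- A fixed point i created by the shift equals the running maximum before i, the element to be
  -- erased from I_i; so it has to be a loop.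
  col i := if h : p.perm i = i ∧ (i : Fin n) ≠ j then p.col ⟨i, h.1⟩ else 1

variable {p j}

/-- A fixed point is never a record: by `le_wt_runMax` the values read before i already reach its
weight. -/
theorem contractFun_of_fixed {i : Fin n} (hj : i ≠ j) (hi : p.perm i = i) :
    contractFun p.perm j i = i := by
  rcases contractFun_cases p.perm hj with ⟨h1, -⟩ | ⟨-, h2⟩
  · have := wt_cases j i
    have := pos_lt j i
    have h3 := le_wt_runMax p.perm (j := j) (m := pos j i) (by omega)
    rw [hi] at h1
    omega
  · rw [h2, hi]

theorem isColoop_contract {i : Fin n} : (p.contract j).IsColoop i ↔ i ≠ j ∧ p.IsColoop i := by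
  constructor
  · rintro ⟨h, hc⟩
    simp only [contract] at hc
    split_ifs at hc with h1
    · exact ⟨h1.2, h1.1, hc⟩
    · exact absurd hc (by decide)
  · rintro ⟨hj, h, hc⟩
    refine ⟨contractFun_of_fixed hj h, ?_⟩
    simp only [contract]
    rw [dif_pos ⟨h, hj⟩, hc]

/-- Both sides say that π⁻¹(j) has been read before t, since j has the greatest weight. Using `wt j
t` makes t = j stand for the whole circle. -/
theorem mem_neck_self_iff_runMax (hj : ¬ p.IsLoop j) {t : Fin n} :
    j ∈ p.neck t ↔ runMax p.perm j (wt j t) = j := by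
  have ht := wt_cases j t
  have hn := pos_lt j t
  by_cases hf : p.perm j = j
  · have h1 : p.IsColoop j := (isLoop_or_isColoop hf).resolve_left hj
    rw [runMax_eq_self p.perm hf (by rw [pos_self]; exact wt_pos _ _)]
    exact iff_of_true (mem_neck.2 (Or.inr h1)) rfl
  · have hc : ¬ p.IsColoop j := fun h => hf h.1
    rw [mem_neck, or_iff_left hc]
    have c1 := pos_change j t j
    have c2 := pos_change j t (p.perm.symm j)
    have l1 := pos_lt j (p.perm.symm j)
    have l2 := wt_cases j (p.perm.symm j)
    have hs : p.perm.symm j ≠ j := fun e => hf ((Equiv.symm_apply_eq _).1 e).symm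
    rw [pos_self] at c1
    constructor
    · intro h
      refine runMax_eq_self p.perm (p.perm.apply_symm_apply j) ?_
      omega
    · intro h
      obtain ⟨a, ha, e⟩ := exists_eq_runMax p.perm (j := j) (wt_pos j t)
      have : a = p.perm.symm j := by rw [Equiv.eq_symm_apply, e, h]
      subst this
      omega

/-- If the maximum is not j, its position lies in [j, t), while by `le_wt_runMax` its value lies
from t on and before j; so the value precedes its preimage in <_t. -/
theorem runMax_mem_neck (hj : ¬ p.IsLoop j) (t : Fin n) : runMax p.perm j (wt j t) ∈ p.neck t := by
  by_cases h : runMax p.perm j (wt j t) = j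
  · rw [h]
    exact (mem_neck_self_iff_runMax hj).2 h
  · have h1 := le_wt_runMax p.perm (j := j) (wt_le j t)
    obtain ⟨a, ha, e⟩ := exists_eq_runMax p.perm (j := j) (wt_pos j t)
    have h2 := wt_cases j (runMax p.perm j (wt j t))
    have h3 := pos_lt j (runMax p.perm j (wt j t))
    have h4 := wt_cases j t
    have h5 := pos_change j t a
    have h6 := pos_change j t (runMax p.perm j (wt j t))
    rw [mem_neck, ← e, Equiv.symm_apply_apply]
    rw [← e] at h h1 h2 h3 h6
    left
    omega

theorem neck_contract (hj : ¬ p.IsLoop j) (t : Fin n) :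
    (p.contract j).neck t = (p.neck t).erase (runMax p.perm j (wt j t)) := by
  ext i
  obtain ⟨b, rfl⟩ : ∃ b, i = contractFun p.perm j b :=
    ⟨(contractPerm p.perm j).symm i, ((contractPerm p.perm j).apply_symm_apply i).symm⟩
  have hs : (p.contract j).perm.symm (contractFun p.perm j b) = b :=
    (contractPerm p.perm j).symm_apply_apply b
  rw [mem_neck, isColoop_contract, hs, Finset.mem_erase]
  by_cases hb : b = j
  · subst hb
    rw [contractFun_self, mem_neck_self_iff_runMax hj]
    simp [eq_comm]
  · have hne := contractFun_ne_self p.perm hb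
    have hb0 := wt_cases j b
    have hbn := pos_lt j b
    have ht0 := wt_cases j t
    have htn := pos_lt j t
    rw [and_iff_right hne]
    rcases contractFun_cases p.perm hb with ⟨h1, h2⟩ | ⟨h1, h2⟩
    · obtain ⟨a, ha, e⟩ := exists_eq_runMax p.perm (j := j) (m := pos j b) (by omega)
      have hw := le_wt_runMax p.perm (j := j) (m := pos j b) (by omega)
      rw [h2] at hne ⊢
      have hi0 := wt_cases j (runMax p.perm j (pos j b))
      have hin := pos_lt j (runMax p.perm j (pos j b))
      have hnc : ¬ p.IsColoop (runMax p.perm j (pos j b)) := by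
        rintro ⟨hf, -⟩
        have := p.perm.injective (e.trans hf.symm)
        subst this
        omega
      rw [mem_neck, or_iff_left hnc, or_iff_left hnc]
      -- The running maximum keeps this value exactly from its record a until the next record b,
      -- which is where moving the preimage from a to b changes membership.
      have hx : runMax p.perm j (wt j t) = runMax p.perm j (pos j b) ↔
          pos j a < wt j t ∧ wt j t ≤ pos j b := by
        constructor
        · intro hx
          constructor
          · obtain ⟨c, hc, ec⟩ := exists_eq_runMax p.perm (j := j) (wt_pos j t)
            rw [hx, ← e] at ec
            rw [← p.perm.injective ec]
            exact hc
          · by_contra hlt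
            have := wt_le_runMax p.perm (not_le.1 hlt)
            rw [hx] at this
            omega
        · rintro ⟨h3, h4⟩
          apply wt_injective j
          refine le_antisymm (wt_runMax_mono p.perm (wt_pos j t) h4) ?_
          rw [← e]
          exact wt_le_runMax p.perm h3
      have ea : p.perm.symm (runMax p.perm j (pos j b)) = a := by
        rw [← e, Equiv.symm_apply_apply]
      rw [ne_eq, eq_comm, hx, ea]
      have c1 := pos_change j t b
      have c2 := pos_change j t a
      have c3 := pos_change j t (runMax p.perm j (pos j b))
      omega
    · rw [h2, mem_neck, Equiv.symm_apply_apply]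
      refine (and_iff_right fun hx => ?_).symm
      obtain ⟨c, hc, ec⟩ := exists_eq_runMax p.perm (j := j) (wt_pos j t)
      rw [← hx] at ec
      have := p.perm.injective ec
      subst this
      have := wt_runMax_mono p.perm (j := j) (m := pos j c) (m' := wt j t) (by omega) (by omega)
      rw [← hx] at this
      omega

theorem cnt_neck_contract (hj : ¬ p.IsLoop j) (t : Fin n) (m : ℕ) :
    cnt ((p.contract j).neck t) t m +
      (if pos t (runMax p.perm j (wt j t)) < m then 1 else 0) = cnt (p.neck t) t m := by
  rw [neck_contract hj, cnt_erase (runMax_mem_neck hj t)]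

theorem pos_runMax_le (t : Fin n) : pos t (runMax p.perm j (wt j t)) ≤ pos t j := by
  have h1 := le_wt_runMax p.perm (j := j) (wt_le j t)
  have h2 := wt_cases j (runMax p.perm j (wt j t))
  have h4 := wt_cases j t
  have h5 := pos_change j t j
  have h6 := pos_change j t (runMax p.perm j (wt j t))
  have h7 := pos_lt j (runMax p.perm j (wt j t))
  rw [pos_self] at h5
  rcases h2 with h2 | h2
  · rw [h2.1]
  · omega

/-- The first segment is [j, t) followed by the first m elements from t, and [j, t) together with
[t, j] covers the circle with j counted twice. -/
theorem cnt_add_cnt (A : Finset (Fin n)) {j t : Fin n} {m : ℕ} (h : pos j t + m ≤ n) (ht : t ≠ j) :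
    cnt A j (pos j t + m) + cnt A t (pos t j + 1) =
      cnt A t m + A.card + if j ∈ A then 1 else 0 := by
  rw [cnt_eq_sum, cnt_eq_sum, cnt_eq_sum, Finset.card_eq_sum_ones,
    ← Finset.sum_ite_eq' A j (fun _ => 1), ← Finset.sum_add_distrib, ← Finset.sum_add_distrib,
    ← Finset.sum_add_distrib]
  refine Finset.sum_congr rfl fun i _ => ?_
  have h1 := pos_change j t i
  have h2 := pos_change j t j
  have h3 := pos_eq_zero (t := j) (i := t)
  have h4 := pos_eq_zero (t := j) (i := i)
  have h5 := pos_lt j i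
  rw [pos_self] at h2
  split_ifs <;> omega

/-- Apply `cnt_add_cnt` to H and to I_t. The Gale bounds at j and at t compare the left sides, and
the strict gain comes from j ∈ H, j ∉ I_t. -/
theorem cnt_lt_of_mem {H : Finset (Fin n)} (hH : H ∈ p.positroid) (hjH : j ∈ H)
    (hj : ¬ p.IsLoop j) {t : Fin n} {m : ℕ} (h1 : pos t (runMax p.perm j (wt j t)) < m)
    (h2 : m ≤ pos t j) : cnt H t m < cnt (p.neck t) t m := by
  have hx : runMax p.perm j (wt j t) ≠ j := fun e => by
    rw [e] at h1
    omega
  have htj : t ≠ j := by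
    rintro rfl
    rw [pos_self] at h2
    omega
  have c1 := pos_change j t j
  have c2 := pos_change j t (runMax p.perm j (wt j t))
  have ht := wt_cases j t
  have hX := wt_cases j (runMax p.perm j (wt j t))
  have hXle := le_wt_runMax p.perm (j := j) (wt_le j t)
  rw [pos_self] at c1
  have hle : pos j t + m ≤ n := by omega
  have e1 := cnt_add_cnt H hle htj
  have e2 := cnt_add_cnt (p.neck t) hle htj
  rw [if_pos hjH] at e1
  rw [if_neg fun hm => hx ((mem_neck_self_iff_runMax hj).1 hm)] at e2
  -- Every value on [j, t) is at most the running maximum, which lies inside this segment. So no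
  -- exchange leaves it, and I_t and I_j have equal counts there.
  have e3 := p.cnt_neck_add j (u := pos j t + m) _ (by omega) t rfl
  rw [Finset.card_eq_zero.2, add_zero] at e3
  · have e4 := (mem_positroid.1 hH j).2 (pos j t + m)
    have e5 := (mem_positroid.1 hH t).2 (pos t j + 1)
    have e6 := (mem_positroid.1 hH t).1
    omega
  · rw [Finset.filter_eq_empty_iff]
    rintro i - ⟨hi1, hi2⟩
    have := wt_le_runMax p.perm (j := j) (a := i) (m := wt j t) (by omega)
    have hi := wt_cases j (p.perm i)
    omega

theorem positroid_contract (hj : ¬ p.IsLoop j) :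
    (p.contract j).positroid = contraction p.positroid {j} := by
  have hcard : ∀ t, ((p.contract j).neck t).card + 1 = (p.neck t).card := fun t => by
    rw [neck_contract hj, Finset.card_erase_add_one (runMax_mem_neck hj t)]
  ext B
  rw [mem_positroid]
  constructor
  · intro hB
    -- At t = j the erased element is j itself, so the new I_j misses j, the first element of <_j.
    have hjB : j ∉ B := by
      intro hjB
      have h1 := (hB j).2 1
      have h2 := cnt_neck_contract hj j 1
      have h3 := pos_runMax_le (p := p) (j := j) j
      rw [pos_self] at h3
      rw [if_pos (by omega)] at h2
      have h4 : cnt (p.neck j) j 1 ≤ 1 := by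
        have := card_filter_pos_lt j (m := 1) (NeZero.one_le)
        exact (Finset.card_le_card
          (Finset.filter_subset_filter _ (Finset.subset_univ _))).trans this.le
      have h5 : 0 < cnt B j 1 := Finset.card_pos.2 ⟨j, by simp [hjB]⟩
      omega
    refine ⟨insert j B, mem_positroid.2 fun t => ?_, by simp, ?_⟩
    · refine ⟨?_, fun m => ?_⟩
      · rw [Finset.card_insert_of_notMem hjB, ← hcard, (hB t).1]
      · rw [cnt_insert hjB, ← cnt_neck_contract hj t m]
        have h1 := (hB t).2 m
        have h2 := pos_runMax_le (p := p) (j := j) t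
        split_ifs <;> omega
    · rw [Finset.sdiff_singleton_eq_erase, Finset.erase_insert hjB]
  · rintro ⟨H, hH, hjH, rfl⟩ t
    rw [Finset.singleton_subset_iff] at hjH
    rw [Finset.sdiff_singleton_eq_erase]
    have hc := (mem_positroid.1 hH t).1
    refine ⟨?_, fun m => ?_⟩
    · have h1 := hcard t
      have h2 := Finset.card_erase_add_one hjH
      omega
    · have h1 := cnt_neck_contract hj t m
      have h2 := cnt_erase hjH t m
      have h3 := (mem_positroid.1 hH t).2 m
      have h4 := pos_runMax_le (p := p) (j := j) t
      -- Only here does the necklace lose an element that H does not lose.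
      have h5 : pos t (runMax p.perm j (wt j t)) < m → m ≤ pos t j →
          cnt H t m < cnt (p.neck t) t m := cnt_lt_of_mem hH hjH hj
      split_ifs at h1 h2 <;> omega

theorem contraction_eq_empty_iff : contraction p.positroid {j} = ∅ ↔ p.IsLoop j := by
  constructor
  · intro h
    by_contra hj
    have h1 := (p.contract j).neck_mem_positroid j
    rw [positroid_contract hj, h] at h1
    exact h1
  · intro h
    rw [Set.eq_empty_iff_forall_notMem]
    rintro B ⟨H, hH, hjH, -⟩
    rw [Finset.singleton_subset_iff] at hjH
    have h1 := (mem_positroid.1 hH j).2 1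
    have h2 : 0 < cnt H j 1 := Finset.card_pos.2 ⟨j, by simp [hjH]⟩
    have h3 : cnt (p.neck j) j 1 = 0 := by
      unfold cnt
      rw [Finset.card_eq_zero, Finset.filter_eq_empty_iff]
      intro i hi hi1
      have : i = j := pos_eq_zero.1 (by omega)
      subst this
      exact isLoop_iff_neck.1 h hi
    omega

/-- The decorated permutation all of whose elements are loops. -/
def allLoops (n : ℕ) : DecoratedPerm n where
  perm := 1
  col _ := 1

theorem positroid_allLoops : (allLoops n).positroid = {∅} := by
  have h : ∀ t, (allLoops n).neck t = ∅ := fun t => by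
    refine Finset.eq_empty_of_forall_notMem fun i hi => ?_
    rcases mem_neck.1 hi with h1 | ⟨_, h1⟩
    · exact lt_irrefl _ h1
    · exact absurd (show (1 : ℤˣ) = -1 from h1) (by decide)
  ext H
  rw [mem_positroid, Set.mem_singleton_iff]
  constructor
  · intro hH
    have := (hH 0).1
    rwa [h, Finset.card_empty, eq_comm, Finset.card_eq_zero] at this
  · rintro rfl t
    rw [h]
    exact ⟨rfl, fun _ => le_rfl⟩

theorem represents_iff_of_not_isLoop (hj : ¬ p.IsLoop j) (q : DecoratedPerm n) :
    q.Represents (contraction p.positroid {j}) ↔ q = p.contract j := by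
  have hne : contraction p.positroid {j} ≠ ∅ := fun h => hj (contraction_eq_empty_iff.1 h)
  rw [Represents, ← positroid_injective.eq_iff, positroid_contract hj]
  exact ⟨fun h => h.1 (Set.nonempty_iff_ne_empty.2 hne),
    fun h => ⟨fun _ => h, fun e => absurd e hne⟩⟩

theorem represents_iff_of_isLoop (hj : p.IsLoop j) (q : DecoratedPerm n) :
    q.Represents (contraction p.positroid {j}) ↔ q = allLoops n := by
  rw [Represents, contraction_eq_empty_iff.2 hj, ← positroid_injective.eq_iff, positroid_allLoops]
  exact ⟨fun h => h.2 rfl, fun h => ⟨fun e => absurd e Set.not_nonempty_empty, fun _ => h⟩⟩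

end DecoratedPerm

end Positroid

/-! ### Correctness of the algorithm -/

namespace Positroid

variable {n : ℕ} [NeZero n]

namespace DecoratedPerm

variable {p : DecoratedPerm n} {j : Fin n}

theorem isLoop_contract_self : (p.contract j).IsLoop j := by
  refine ⟨contractFun_self _ _, ?_⟩
  simp only [contract]
  exact dif_neg fun h => h.2 rfl

theorem isLoop_contract_of_perm_ne {i : Fin n} (h : p.perm i ≠ i)
    (hi : contractFun p.perm j i = i) : (p.contract j).IsLoop i := by
  refine ⟨hi, ?_⟩
  simp only [contract]
  exact dif_neg fun h' => h h'.1

theorem partialCol_contract_of_eq {i : Fin n} (hi : i ≠ j)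
    (h : contractFun p.perm j i = p.perm i) : (p.contract j).partialCol i = p.partialCol i := by
  by_cases hf : p.perm i = i
  · rw [partialCol, partialCol, dif_pos hf, dif_pos (show (p.contract j).perm i = i from h.trans hf)]
    simp only [contract]
    rw [dif_pos ⟨hf, hi⟩]
  · rw [partialCol_eq_none hf,
      partialCol_eq_none (show (p.contract j).perm i ≠ i from fun e => hf (h.symm.trans e))]

/-- The value j is read first and is the greatest, so no later record displaces anything. -/
theorem contractFun_eq_of_perm_self (hj : p.perm j = j) (i : Fin n) :
    contractFun p.perm j i = p.perm i := by
  by_cases hi : i = j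
  · rw [hi, contractFun_self, hj]
  · rcases contractFun_cases p.perm hi with ⟨h1, -⟩ | ⟨-, h2⟩
    · rw [runMax_eq_self p.perm hj (by rw [pos_self]; have := wt_cases j i; tauto), wt_self] at h1
      exact absurd (wt_le _ _) h1.not_ge
    · exact h2

end DecoratedPerm

variable {p : DecoratedPerm n} {j : Fin n}

/-- The invariant of the contraction algorithm: `q` is the running maximum at `a`, the output is
final before `a`, and still the input from `a` on. -/
structure AlgInv (p : DecoratedPerm n) (j : Fin n) (s : AlgState n) : Prop where
  pos_a : 0 < pos j s.a
  le_a : pos j s.a ≤ pos j (p.perm.symm j)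
  q_eq : s.q = runMax p.perm j (pos j s.a)
  μ_eq : ∀ i, s.μ i = if pos j i < pos j s.a then contractFun p.perm j i else p.perm i
  col_eq : ∀ i, s.col i =
    if pos j i < pos j s.a then (p.contract j).partialCol i else p.partialCol i

theorem algInv_algInit (hj : p.perm j ≠ j) : AlgInv p j (algInit p j) := by
  have hs : p.perm.symm j ≠ j := fun e => hj ((Equiv.symm_apply_eq _).1 e).symm
  have h0 := wt_cases j (p.perm.symm j)
  have hn := pos_lt j (p.perm.symm j)
  have h1 : pos j (j + 1) = 1 := by
    have := pos_add_one j j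
    rw [pos_self] at this
    omega
  have key : ∀ i, pos j i < 1 ↔ i = j := fun i => by
    rw [Nat.lt_one_iff, pos_eq_zero]
  refine ⟨?_, ?_, ?_, ?_, ?_⟩ <;> simp only [algInit, h1]
  · exact Nat.one_pos
  · omega
  · refine (runMax_eq p.perm (by simp) fun b hb => ?_).symm
    rw [(key b).1 hb]
  · intro i
    rw [Function.update_apply]
    simp only [key]
    split_ifs with h
    · rw [h, contractFun_self]
    · rfl
  · intro i
    rw [Function.update_apply]
    simp only [key]
    split_ifs with h
    · rw [h, DecoratedPerm.isLoop_contract_self.partialCol_eq]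
    · rfl

variable {s : AlgState n}

theorem AlgInv.wt_ne (hs : AlgInv p j s) : wt j s.q ≠ wt j (p.perm s.a) := by
  intro e
  obtain ⟨b, hb, eb⟩ := exists_eq_runMax p.perm (j := j) hs.pos_a
  rw [← hs.q_eq, wt_injective j e] at eb
  rw [p.perm.injective eb] at hb
  omega

theorem AlgInv.a_ne (hs : AlgInv p j s) : s.a ≠ j := fun e => by
  have := hs.pos_a
  rw [e, pos_self] at this
  omega

theorem AlgInv.contractFun_of_lt (hs : AlgInv p j s) (h : wt j s.q < wt j (p.perm s.a)) :
    contractFun p.perm j s.a = s.q := by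
  rw [contractFun, if_neg hs.a_ne, ← hs.q_eq, if_pos h]

theorem AlgInv.contractFun_of_not_lt (hs : AlgInv p j s) (h : ¬ wt j s.q < wt j (p.perm s.a)) :
    contractFun p.perm j s.a = p.perm s.a := by
  rw [contractFun, if_neg hs.a_ne, ← hs.q_eq, if_neg h]

theorem pos_lt_succ_iff {i a : Fin n} : pos j i < pos j a + 1 ↔ i = a ∨ pos j i < pos j a := by
  rw [Nat.lt_succ_iff_lt_or_eq, (pos_injective j).eq_iff, or_comm]

theorem AlgInv.algAssign_μ (hs : AlgInv p j s) (h : wt j s.q < wt j (p.perm s.a)) (i : Fin n) :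
    (algAssign s).μ i = if pos j i < pos j s.a + 1 then contractFun p.perm j i else p.perm i := by
  simp only [algAssign, Function.update_apply, pos_lt_succ_iff]
  by_cases hi : i = s.a
  · rw [if_pos hi, if_pos (Or.inl hi), hi, hs.contractFun_of_lt h]
  · rw [if_neg hi, hs.μ_eq]
    simp only [hi, false_or]

theorem AlgInv.le_wt_q (hs : AlgInv p j s) : pos j s.a ≤ wt j s.q := by
  rw [hs.q_eq]
  exact le_wt_runMax p.perm (pos_lt _ _).le

theorem AlgInv.algAssign_col (hs : AlgInv p j s) (h : wt j s.q < wt j (p.perm s.a)) (i : Fin n) :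
    (algAssign s).col i =
      if pos j i < pos j s.a + 1 then (p.contract j).partialCol i else p.partialCol i := by
  have hfix : p.perm s.a ≠ s.a := by
    intro e
    have h1 := hs.le_wt_q
    have h2 := wt_cases j s.a
    have h3 := hs.pos_a
    rw [e] at h
    omega
  have hcf := hs.contractFun_of_lt h
  simp only [algAssign, Function.update_self, pos_lt_succ_iff]
  by_cases hi : i = s.a
  · rw [if_pos (Or.inl hi), hi]
    by_cases hq : s.q = s.a
    · rw [if_pos hq, Function.update_self,
        (DecoratedPerm.isLoop_contract_of_perm_ne hfix (hcf.trans hq)).partialCol_eq]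
    · rw [if_neg hq, hs.col_eq, if_neg (lt_irrefl _), DecoratedPerm.partialCol_eq_none hfix,
        DecoratedPerm.partialCol_eq_none]
      exact fun e => hq (hcf.symm.trans e)
  · have : (if s.q = s.a then Function.update s.col s.a (some 1) else s.col) i = s.col i := by
      split_ifs
      · exact Function.update_of_ne hi _ _
      · rfl
    rw [this, hs.col_eq]
    simp only [hi, false_or]

/-- The test in the loop body asks whether `π(a)` exceeds the running maximum `q`. -/
theorem AlgInv.test_iff (hs : AlgInv p j s) (ha : p.perm s.a ≠ j) :
    (s.q = s.a ∨ (cycLT (s.a + 1) s.q (p.perm s.a) ∧ cycLT (s.a + 1) (p.perm s.a) j)) ↔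
      wt j s.q < wt j (p.perm s.a) := by
  rw [cycLT_iff, cycLT_iff]
  have hq := hs.le_wt_q
  -- Otherwise π⁻¹(j) would come before a.
  have hqj : s.q ≠ j := by
    intro e
    obtain ⟨b, hb, eb⟩ := exists_eq_runMax p.perm (j := j) hs.pos_a
    rw [← hs.q_eq, e, ← Equiv.eq_symm_apply] at eb
    subst eb
    have := hs.le_a
    omega
  have h0 := hs.pos_a
  have hne := hs.wt_ne
  have w1 := wt_cases j s.q
  have w2 := wt_cases j (p.perm s.a)
  have b1 := pos_lt j s.q
  have b2 := pos_lt j (p.perm s.a)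
  have b3 := pos_lt j s.a
  -- The case q = a needs its own test, since a is last in <_{a+1}. There the pigeonhole bound for
  -- one more position forces π(a) to be a record. If q ≠ a, then q lies strictly between a and j,
  -- where <_{a+1} agrees with the order by weight.
  have hsucc := runMax_succ p.perm h0
  have hle := le_wt_runMax p.perm (j := j) (m := pos j s.a + 1) b3
  rw [← hs.q_eq] at hsucc
  have heq := (pos_injective j).eq_iff (a := s.q) (b := s.a)
  have c0 := pos_add_one j s.a
  have c1 := pos_change j (s.a + 1) s.q
  have c2 := pos_change j (s.a + 1) (p.perm s.a)
  have c3 := pos_change j (s.a + 1) j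
  rw [pos_self] at c3
  by_cases h : wt j s.q < wt j (p.perm s.a)
  · refine iff_of_true ?_ h
    omega
  · rw [if_neg h] at hsucc
    rw [hsucc] at hle
    refine iff_of_false ?_ h
    omega

theorem AlgInv.algBody (hs : AlgInv p j s) (ha : p.perm s.a ≠ j) :
    AlgInv p j (algBody p j s) := by
  have hlt : pos j s.a < pos j (p.perm.symm j) := by
    refine lt_of_le_of_ne hs.le_a fun e => ha ?_
    rw [pos_injective j e, Equiv.apply_symm_apply]
  have hbd := pos_lt j (p.perm.symm j)
  have h1 : pos j (s.a + 1) = pos j s.a + 1 := by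
    have := pos_add_one j s.a
    omega
  have hrm := runMax_succ p.perm hs.pos_a
  rw [← hs.q_eq] at hrm
  have htest := hs.test_iff ha
  by_cases h : wt j s.q < wt j (p.perm s.a)
  · rw [if_pos h] at hrm
    have e : Positroid.algBody p j s =
        { algAssign s with q := p.perm s.a, a := s.a + 1 } := by
      simp only [Positroid.algBody]
      rw [if_pos (htest.2 h)]
    rw [e]
    refine ⟨?_, ?_, ?_, ?_, ?_⟩ <;> simp only [h1]
    · omega
    · omega
    · exact hrm.symm
    · exact hs.algAssign_μ h
    · exact hs.algAssign_col h
  · rw [if_neg h] at hrm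
    have e : Positroid.algBody p j s = { s with a := s.a + 1 } := by
      simp only [Positroid.algBody]
      rw [if_neg (mt htest.1 h)]
    have hcf := hs.contractFun_of_not_lt h
    rw [e]
    refine ⟨?_, ?_, ?_, ?_, ?_⟩ <;> simp only [h1]
    · omega
    · omega
    · exact hrm.symm
    · intro i
      rw [hs.μ_eq]
      simp only [pos_lt_succ_iff]
      by_cases hi : i = s.a
      · rw [if_neg (by rw [hi]; exact lt_irrefl _), if_pos (Or.inl hi), hi, hcf]
      · simp only [hi, false_or]
    · intro i
      rw [hs.col_eq]
      simp only [pos_lt_succ_iff]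
      by_cases hi : i = s.a
      · rw [if_neg (by rw [hi]; exact lt_irrefl _), if_pos (Or.inl hi), hi,
          DecoratedPerm.partialCol_contract_of_eq hs.a_ne hcf]
      · simp only [hi, false_or]

theorem AlgInv.algLoop (hs : AlgInv p j s) :
    AlgInv p j (algLoop p j s) ∧ p.perm (algLoop p j s).a = j := by
  fun_induction Positroid.algLoop p j s with
  | case1 s h => exact ⟨hs, h⟩
  | case2 s h ih => exact ih (hs.algBody h)

theorem contractFun_of_symm_lt {i : Fin n} (h : pos j (p.perm.symm j) < pos j i) :
    contractFun p.perm j i = p.perm i := by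
  have hi : i ≠ j := by
    rintro rfl
    rw [pos_self] at h
    omega
  rcases contractFun_cases p.perm hi with ⟨h1, -⟩ | ⟨-, h2⟩
  · rw [runMax_eq_self p.perm (p.perm.apply_symm_apply j) h, wt_self] at h1
    exact absurd (wt_le _ _) h1.not_ge
  · exact h2

/-- The contraction algorithm computes the decorated permutation `p.contract j`. -/
theorem contractionAlg_eq (hj : p.perm j ≠ j) :
    (contractionAlg p j).μ = (p.contract j).perm ∧
      (contractionAlg p j).col = (p.contract j).partialCol := by
  obtain ⟨hs, ha⟩ := (algInv_algInit hj).algLoop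
  have ha' : p.perm.symm j = (algLoop p j (algInit p j)).a := by
    rw [Equiv.symm_apply_eq, ha]
  -- On exit π(a) = j has the greatest weight, so a is the last record and the final assignment is
  -- one more record step.
  have h : wt j (algLoop p j (algInit p j)).q < wt j (p.perm (algLoop p j (algInit p j)).a) := by
    have h1 := hs.wt_ne
    rw [ha, wt_self] at h1 ⊢
    exact lt_of_le_of_ne (wt_le _ _) h1
  have key : ∀ i, ¬ pos j i < pos j (algLoop p j (algInit p j)).a + 1 →
      i ≠ j ∧ contractFun p.perm j i = p.perm i := by
    intro i hi
    refine ⟨?_, contractFun_of_symm_lt (by rw [ha']; omega)⟩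
    rintro rfl
    rw [pos_self] at hi
    omega
  constructor
  · funext i
    refine (hs.algAssign_μ h i).trans ?_
    split_ifs with hi
    · rfl
    · exact (key i hi).2.symm
  · funext i
    refine (hs.algAssign_col h i).trans ?_
    split_ifs with hi
    · rfl
    · exact (DecoratedPerm.partialCol_contract_of_eq (key i hi).1 (key i hi).2).symm

end Positroid

theorem mainTheorem1 {n : ℕ} [NeZero n] (π : Positroid.DecoratedPerm n) (j : Fin n) :
    ∃ μ : Positroid.DecoratedPerm n,
      -- `μ` is the decorated permutation of the contraction by `{j}`
      (∀ ν : Positroid.DecoratedPerm n,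
        ν.Represents (Positroid.contraction π.positroid {j}) ↔ ν = μ) ∧
      -- the convention for empty families is used only if `j` is a fixed point of colour `1`
      (Positroid.contraction π.positroid {j} = ∅ ↔ ∃ h : π.perm j = j, π.col ⟨j, h⟩ = 1) ∧
      (π.perm j ≠ j →
        (Positroid.contractionAlg π j).μ = μ.perm ∧
        (Positroid.contractionAlg π j).col = μ.partialCol) ∧
      (∀ h : π.perm j = j, π.col ⟨j, h⟩ = -1 →
        μ.perm = π.perm ∧ μ.partialCol j = some 1 ∧
        ∀ i, i ≠ j → μ.partialCol i = π.partialCol i) ∧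
      (∀ h : π.perm j = j, π.col ⟨j, h⟩ = 1 →
        μ.perm = 1 ∧ ∀ i, μ.partialCol i = some 1) := by
  by_cases hj : π.IsLoop j
  · refine ⟨Positroid.DecoratedPerm.allLoops n, Positroid.DecoratedPerm.represents_iff_of_isLoop hj,
      Positroid.DecoratedPerm.contraction_eq_empty_iff, fun h => absurd hj.1 h,
      fun h hc => absurd hj (Positroid.DecoratedPerm.IsColoop.not_isLoop ⟨h, hc⟩),
      fun _ _ => ⟨rfl, fun i => ?_⟩⟩
    exact Positroid.DecoratedPerm.IsLoop.partialCol_eq ⟨rfl, rfl⟩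
  -- The coloop case belongs here too: the shift is then trivial and only the colour of j changes.
  · refine ⟨π.contract j, Positroid.DecoratedPerm.represents_iff_of_not_isLoop hj,
      Positroid.DecoratedPerm.contraction_eq_empty_iff, Positroid.contractionAlg_eq, fun h _ => ⟨Equiv.ext
        (Positroid.DecoratedPerm.contractFun_eq_of_perm_self h),
        Positroid.DecoratedPerm.isLoop_contract_self.partialCol_eq, fun i hi =>
        Positroid.DecoratedPerm.partialCol_contract_of_eq hi
          (Positroid.DecoratedPerm.contractFun_eq_of_perm_self h i)⟩, fun h hc => absurd ⟨h, hc⟩ hj⟩
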